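/- **Definitions.** For $x\in[m]^n$ the element $k$-distinctness function $f=f_{n,m,k}$ is $1$ iff $k$ of the positions of $x$ hold equal values. A *learning graph* on $n$ inputs is a finite directed graph whose vertices are subsets of the $n$-element index set $\{1,\dots,n\}$, all reachable from $\emptyset$, whose arcs (*transitions*) $e=(S,S')$ satisfy $S\subsetneq S'$; the *length* is $\ell(e)=|S'\setminus S|$. Stage $i$ consists of the transitions from vertices at distance $i-1$ from $\emptyset$ to vertices at distance $i$. A learning graph for $f$ carries in addition weights $w_e>0$ and, for each $x\in f^{-1}(1)$, a unit flow $p(x)\ge 0$ originating from $\emptyset$, preserved at every other vertex that has an outgoing transition, and ending only in vertices that contain a 1-certificate of $x$. Its complexity is $$\Big(\sum_e \ell(e)\,w_e\Big)^{1/2}\Big(\max_{x\in f^{-1}(1)}\sum_e \ell(e)\,\frac{p_e(x)^2}{w_e}\Big)^{1/2}.$$ A transition is *valid* for $x$ if $p_e(x)>0$. The symmetric group $S_n$ acts on transitions; the *speciality* of $e$ is the size of its equivalence class divided by the number of valid transitions in that class. The graph is *symmetric* on a stage if the flows through valid equivalent transitions of that stage are equal, and neither these flows nor the specialities depend on $x$.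 The average length of stage $i$ is $\sum_{e \text{ in stage } i}p_e(x)\ell(e)$. **Statement.** Fix an integer $k\ge 1$. For every $x\in f^{-1}(1)$ choose distinct marked positions $a_1,\dots,a_k$ (depending on $x$) at which $x$ has equal values. 1. For every $c<1$ there is a constant $C$, depending only on $k$ and $c$, such that for all $n,m$ and all integers $r$ with $k<r\le cn$, and every choice of marked positions, there is a learning graph for element $k$-distinctness with exactly the following $k+1$ stages. Stage $1$ consists of all transitions from $\emptyset$ to a set of size $r-k$; stage $j$ ($2\le j\le k+1$) consists of all transitions $S\to S\cup\{b\}$ with $|S|=r-k+j-2$, $b\notin S$. The flow for $x$ is $\binom{n-k}{r-k}^{-1}$ on the transitions of stage $1$ that query no marked element and on the transitions of stage $j$ that query $b=a_{j-1}$ from a set $S$ whose marked elements are exactly $a_1,\dots,a_{j-2}$, and is $0$ on all other transitions (so it loads $r-k$ uniformly random non-marked elements and then $a_1,\dots,a_k$ one at a time). This graph is invariant under $S_n$ and symmetric on every stage. Stage $1$ has average length $r-k$ and speciality at most $C$. Stage $j$, for $2\le j\le k+1$, has average length $1$ and speciality at most $C\,n^{j-1}/r^{j-2}$. For suitable weights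 the complexity of the graph is at most $$C\Big(r+\sum_{j=1}^{k}\sqrt{n^j/r^{j-1}}\Big).$$ 2. For all integers $n\ge 0$ and $r\ge 1$, $\; r+\sum_{j=1}^{k}\sqrt{n^j/r^{j-1}}\ \ge\ n^{k/(k+1)}$. 3. For $r=\lceil n^{k/(k+1)}\rceil$ this is optimal up to a constant: there are $C$ and $n_0$, depending only on $k$, such that for all $n\ge n_0$ one has $k<r\le n$ and $r+\sum_{j=1}^{k}\sqrt{n^j/r^{j-1}}\le C\,n^{k/(k+1)}$, and for every $m$ and every choice of marked positions there is a learning graph for element $k$-distinctness with the stages and flow described in 1 (for this $r$) and of complexity at most $C\,n^{k/(k+1)}$. -/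

import Mathlib

/-- A potential transition `(S, S')` of a learning graph on the input indices `Fin n`. -/
abbrev Transition (n : ℕ) : Type := Finset (Fin n) × Finset (Fin n)

/-- The length `|S' \ S|` of the transition `(S, S')`. -/
def Transition.length {n : ℕ} (e : Transition n) : ℕ := (e.2 \ e.1).card

/-- The action of a permutation of the input indices on transitions. -/
def Transition.act {n : ℕ} (g : Equiv.Perm (Fin n)) (e : Transition n) : Transition n :=
  (e.1.map g.toEmbedding, e.2.map g.toEmbedding)

/-- The set `S` of input positions contains a 1-certificate of `x` for `f`: the values of `x`
on `S` force the value of `f` to be 1. -/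
def ContainsOneCertificate {n m : ℕ} (f : (Fin n → Fin m) → Bool) (x : Fin n → Fin m)
    (S : Finset (Fin n)) : Prop :=
  ∀ y : Fin n → Fin m, (∀ i ∈ S, y i = x i) → f y = true

/-- A (reduced) learning graph: a directed graph on subsets of the set of input indices, given by
its finite set of transitions `(S, S')`, all of which satisfy `S ⊂ S'` (so there are no directed
cycles), and every vertex of which is reachable from `∅`. -/
structure LearningGraph (n : ℕ) where
  transitions : Finset (Transition n)
  ssubset : ∀ e ∈ transitions, e.1 ⊂ e.2
  connected : ∀ e ∈ transitions,
    Relation.ReflTransGen (fun S S' : Finset (Fin n) => (S, S') ∈ transitions) ∅ e.1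

namespace LearningGraph

variable {n : ℕ}

/-- The vertices that are reached from `∅` by a directed path of exactly `d` transitions. -/
def reach (G : LearningGraph n) : ℕ → Finset (Finset (Fin n))
  | 0 => {∅}
  | d + 1 => (G.transitions.filter fun e => e.1 ∈ G.reach d).image Prod.snd

/-- The number of transitions required to connect a vertex to `∅`. -/
noncomputable def distance (G : LearningGraph n) (S : Finset (Fin n)) : ℕ :=
  sInf {d | S ∈ G.reach d}

/-- The `i`-th stage (`i ≥ 1`): all transitions from the layer at distance `i - 1` to the layer
at distance `i`. -/
noncomputable def stage (G : LearningGraph n) (i : ℕ) : Finset (Transition n) :=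
  G.transitions.filter fun e => G.distance e.1 + 1 = i ∧ G.distance e.2 = i

/-- The total flow entering the vertex `S`. -/
def inflow (G : LearningGraph n) (p : Transition n → ℝ) (S : Finset (Fin n)) : ℝ :=
  ∑ e ∈ G.transitions.filter (fun e => e.2 = S), p e

/-- The total flow leaving the vertex `S`. -/
def outflow (G : LearningGraph n) (p : Transition n → ℝ) (S : Finset (Fin n)) : ℝ :=
  ∑ e ∈ G.transitions.filter (fun e => e.1 = S), p e

/-- `p` is a unit flow on `G` for the input `x` of `f`: it originates from `∅`, is preserved at
every other vertex at which the graph does not terminate, and every vertex at which the graph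
terminates and which receives flow contains a 1-certificate of `x`. -/
structure IsFlow (G : LearningGraph n) {m : ℕ} (f : (Fin n → Fin m) → Bool) (x : Fin n → Fin m)
    (p : Transition n → ℝ) : Prop where
  nonneg : ∀ e ∈ G.transitions, 0 ≤ p e
  support : ∀ e, e ∉ G.transitions → p e = 0
  source : G.outflow p ∅ = 1
  conservation : ∀ S, S ≠ ∅ → (∃ e ∈ G.transitions, e.1 = S) → G.inflow p S = G.outflow p S
  sink : ∀ S, (¬ ∃ e ∈ G.transitions, e.1 = S) → 0 < G.inflow p S →
    ContainsOneCertificate f x S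

/-- The transitions of `G` equivalent to `e` under permutations of the input indices. -/
def equivClass (G : LearningGraph n) (e : Transition n) : Finset (Transition n) :=
  G.transitions.filter fun e' => ∃ g : Equiv.Perm (Fin n), Transition.act g e = e'

end LearningGraph

/-- A learning graph for the function `f`: a learning graph with positive weights on its
transitions and, for every input `x` with `f x = 1`, a unit flow for `x`. -/
structure LearningGraphFor {n m : ℕ} (f : (Fin n → Fin m) → Bool) extends LearningGraph n where
  weight : Transition n → ℝ
  weight_pos : ∀ e ∈ transitions, 0 < weight e
  flow : (Fin n → Fin m) → Transition n → ℝ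
  isFlow : ∀ x, f x = true → toLearningGraph.IsFlow f x (flow x)

namespace LearningGraphFor

variable {n m : ℕ} {f : (Fin n → Fin m) → Bool}

/-- `∑ ℓ(e) w(e)` over all transitions. -/
def negativeComplexity (G : LearningGraphFor f) : ℝ :=
  ∑ e ∈ G.transitions, (e.length : ℝ) * G.weight e

/-- The maximum, over the inputs `x` with `f x = 1`, of `∑ ℓ(e) p_e(x)² / w(e)`. -/
noncomputable def positiveComplexity (G : LearningGraphFor f) : ℝ :=
  ⨆ x : {x : Fin n → Fin m // f x = true},
    ∑ e ∈ G.transitions, (e.length : ℝ) * G.flow x.1 e ^ 2 / G.weight e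

/-- The complexity: the geometric mean of the negative and the positive complexity. -/
noncomputable def complexity (G : LearningGraphFor f) : ℝ :=
  √(G.negativeComplexity * G.positiveComplexity)

/-- A transition is valid for `x` if it is used in the flow for `x`. -/
def Valid (G : LearningGraphFor f) (x : Fin n → Fin m) (e : Transition n) : Prop :=
  0 < G.flow x e

open Classical in
/-- The speciality `τ(e)` (for the flow of the input `x`): the size of the equivalence class of
`e` divided by the number of valid transitions in it. -/
noncomputable def speciality (G : LearningGraphFor f) (x : Fin n → Fin m) (e : Transition n) : ℝ :=
  ((G.equivClass e).card : ℝ) / (((G.equivClass e).filter (G.Valid x)).card : ℝ)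

/-- The average length of stage `i` (for the flow of the input `x`). -/
noncomputable def averageLength (G : LearningGraphFor f) (x : Fin n → Fin m) (i : ℕ) : ℝ :=
  ∑ e ∈ G.stage i, G.flow x e * (e.length : ℝ)

/-- The graph is invariant under permutations of the input indices. -/
def IsInvariant (G : LearningGraphFor f) : Prop :=
  ∀ g : Equiv.Perm (Fin n), ∀ e ∈ G.transitions, Transition.act g e ∈ G.transitions

/-- Symmetry on stage `i`: the flows through valid equivalent transitions of the stage are equal,
and neither this common value nor the speciality depends on the input. -/
structure IsSymmetricOn (G : LearningGraphFor f) (i : ℕ) : Prop where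
  flow_eq : ∀ e ∈ G.stage i, ∀ e' ∈ G.stage i, e' ∈ G.equivClass e →
    ∀ x x', f x = true → f x' = true → G.Valid x e → G.Valid x' e' → G.flow x e = G.flow x' e'
  speciality_eq : ∀ e ∈ G.stage i, ∀ x x', f x = true → f x' = true →
    G.speciality x e = G.speciality x' e

end LearningGraphFor

/-- Element `k`-distinctness: the value is 1 iff there are `k` positions holding equal elements. -/
def kDistinctness (n m k : ℕ) (x : Fin n → Fin m) : Bool :=
  decide (∃ T : Finset (Fin n), T.card = k ∧ ∀ i ∈ T, ∀ j ∈ T, x i = x j)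

/-- A choice, for every 1-input `x` of `k`-distinctness, of distinct marked elements
`a x 0, …, a x (k - 1)`, that is, of `k` distinct positions holding equal elements. -/
def IsMarking {n m k : ℕ} (a : (Fin n → Fin m) → Fin k → Fin n) : Prop :=
  ∀ x, kDistinctness n m k x = true →
    Function.Injective (a x) ∧ ∀ i j, x (a x i) = x (a x j)

/-- The transitions of the stages of the learning graph for `k`-distinctness: stage 1 queries
`r - k` elements at once, and each of the stages `2, …, k + 1` queries one more element. -/
def kDistinctnessStage (n k r : ℕ) : ℕ → Finset (Transition n)
  | 0 => ∅
  | 1 => Finset.univ.filter fun e => e.1 = ∅ ∧ e.2.card = r - k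
  | j + 2 => Finset.univ.filter fun e =>
      e.1.card = r - k + j ∧ e.1 ⊆ e.2 ∧ e.2.card = e.1.card + 1

/-- The transitions of a stage that carry flow when the marked elements are `a 0, …, a (k - 1)`:
in stage 1, those that query only non-marked elements; in stage `j + 2`, those that query `a j`
from a vertex whose marked elements are exactly `a 0, …, a (j - 1)`. -/
def KDistinctnessValid {n k : ℕ} (a : Fin k → Fin n) : ℕ → Transition n → Prop
  | 0, _ => False
  | 1, e => ∀ i, a i ∉ e.2
  | j + 2, e => (∀ i : Fin k, a i ∈ e.1 ↔ (i : ℕ) < j) ∧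
      ∃ i : Fin k, (i : ℕ) = j ∧ e.2 = insert (a i) e.1

/-- `G` is the learning graph with `k + 1` stages that first loads `r - k` non-marked elements,
uniformly at random, and then the marked elements, one at a time. -/
structure IsKDistinctnessGraph {n m k : ℕ} (r : ℕ) (a : (Fin n → Fin m) → Fin k → Fin n)
    (G : LearningGraphFor (kDistinctness n m k)) : Prop where
  transitions_eq : G.transitions = (Finset.Icc 1 (k + 1)).biUnion (kDistinctnessStage n k r)
  stage_eq : ∀ i ∈ Finset.Icc 1 (k + 1), G.stage i = kDistinctnessStage n k r i
  flow_valid : ∀ x, kDistinctness n m k x = true → ∀ i ∈ Finset.Icc 1 (k + 1),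
    ∀ e ∈ kDistinctnessStage n k r i, KDistinctnessValid (a x) i e →
      G.flow x e = ((n - k).choose (r - k) : ℝ)⁻¹
  flow_invalid : ∀ x, kDistinctness n m k x = true → ∀ i ∈ Finset.Icc 1 (k + 1),
    ∀ e ∈ kDistinctnessStage n k r i, ¬ KDistinctnessValid (a x) i e → G.flow x e = 0

/-- `r + ∑_{j=1}^{k} √(n^j / r^(j-1))`. -/
noncomputable def kDistinctnessBound (n k r : ℕ) : ℝ :=
  (r : ℝ) + ∑ j ∈ Finset.Icc 1 k, √((n : ℝ) ^ j / (r : ℝ) ^ (j - 1))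

/-!
The graph is forced by its stages and its flow; only the weights are free. Write `N i` for the
number of transitions of stage `i`, `ℓ i` for their common length and `V = (n - k).choose (r - k)`.

On every stage a valid transition is determined by its `r - k` non-marked elements
(`card_filter_valid`), so exactly `V` transitions are valid, each with flow `1 / V`. The symmetric
group acts transitively on every stage (`exists_act_eq`): two subsets of the same size are related
by a permutation, and the queried element is then adjusted by a transposition. Hence equivalence
classes are stages, and the speciality on stage `i` is `N i / V` for every positive input. Flow is
conserved because a vertex `S` with `r - k + j` elements receives and emits the same amount:
`1 / V` if its marked elements are exactly the first `j`, and `0` otherwise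
(`inflow_kDistinctnessFlow`, `outflow_kDistinctnessFlow`).

With weight `1 / √(N i * V)` on stage `i`, both the negative and the positive complexity are
`∑ i, ℓ i * √(N i / V)` (`complexity_kDistinctnessGraphFor_le`). It remains to bound `N i / V`. From
`C(n, s + j) (s + 1) ^ j ≤ n ^ j C(n, s)`, `(1 - c) ^ k C(n, s) ≤ C(n - k, s)` and
`r ≤ k (s + 1)`, where `s = r - k`, one gets (`choose_le_div_pow_mul`)
`C(n, r - k + j) ≤ (k / (1 - c)) ^ k * (n / r) ^ j * V`,
and stage `j + 2` has at most `n * C(n, r - k + j)` transitions.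

For the dependence on `r`, put `n = t ^ (k + 1)`, so that `n ^ (k / (k + 1)) = t ^ k`. If
`r < t ^ k` then the last summand of the bound is at least `t ^ k`; if `t ^ k ≤ r ≤ 2 t ^ k` and
`1 ≤ t` then every summand is at most `t ^ k`, and `r ≤ n / 2` as soon as `t ≥ 4`.
-/

/-! ### Binomial coefficients -/

/-- Discarding one point of the ground set loses at most a factor `1 - c` of the `s`-subsets when
`s` is at most the fraction `c` of the ground set. -/
theorem one_sub_mul_choose_succ_le {c : ℝ} {N s : ℕ} (h : (s : ℝ) ≤ c * (N + 1)) :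
    (1 - c) * ((N + 1).choose s : ℝ) ≤ (N.choose s : ℝ) := by
  rcases le_or_gt s (N + 1) with hs | hs
  · have h1 := Nat.choose_mul_succ_eq N s
    have h2 : (N.choose s : ℝ) * (N + 1) = ((N + 1).choose s : ℝ) * ((N : ℝ) + 1 - s) := by
      have h3 : ((N + 1 - s : ℕ) : ℝ) = (N : ℝ) + 1 - s := by
        rw [Nat.cast_sub hs]; push_cast; ring
      rw [← h3]; exact_mod_cast h1
    have hN : (0 : ℝ) < N + 1 := by positivity
    have h4 : (0 : ℝ) ≤ ((N + 1).choose s : ℝ) := by positivity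
    refine le_of_mul_le_mul_right ?_ hN
    rw [h2]
    nlinarith
  · simp [Nat.choose_eq_zero_of_lt hs]

theorem one_sub_pow_mul_choose_le {c : ℝ} (hc : c ≤ 1) {n k s : ℕ} (hk : k ≤ n)
    (h : (s : ℝ) + k ≤ c * n) :
    (1 - c) ^ k * (n.choose s : ℝ) ≤ ((n - k).choose s : ℝ) := by
  induction k with
  | zero => simp
  | succ k ih =>
    push_cast at h
    have h1 := ih (by omega) (by linarith)
    have h2 : n - k = (n - (k + 1)) + 1 := by omega
    have h3 : (1 - c) * (((n - (k + 1)) + 1).choose s : ℝ) ≤ ((n - (k + 1)).choose s : ℝ) := by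
      apply one_sub_mul_choose_succ_le
      rw [Nat.cast_sub hk]
      push_cast
      nlinarith [(Nat.cast_nonneg k : (0 : ℝ) ≤ k)]
    rw [← h2] at h3
    calc (1 - c) ^ (k + 1) * (n.choose s : ℝ)
        = (1 - c) * ((1 - c) ^ k * (n.choose s : ℝ)) := by ring
      _ ≤ (1 - c) * ((n - k).choose s : ℝ) := by
          apply mul_le_mul_of_nonneg_left h1; linarith
      _ ≤ _ := h3

theorem choose_add_mul_succ_pow_le (n s j : ℕ) :
    n.choose (s + j) * (s + 1) ^ j ≤ n ^ j * n.choose s := by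
  induction j with
  | zero => simp
  | succ j ih =>
    have h1 : n.choose (s + j + 1) * (s + j + 1) ≤ n.choose (s + j) * n := by
      rw [Nat.choose_succ_right_eq]
      exact Nat.mul_le_mul_left _ (Nat.sub_le _ _)
    calc n.choose (s + (j + 1)) * (s + 1) ^ (j + 1)
        = n.choose (s + j + 1) * (s + 1) * (s + 1) ^ j := by rw [← add_assoc]; ring
      _ ≤ n.choose (s + j + 1) * (s + j + 1) * (s + 1) ^ j := by gcongr; omega
      _ ≤ n.choose (s + j) * n * (s + 1) ^ j := by gcongr
      _ = n * (n.choose (s + j) * (s + 1) ^ j) := by ring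
      _ ≤ n * (n ^ j * n.choose s) := by gcongr
      _ = _ := by ring

/-- The total number of `(s + j)`-subsets is compared with the number of `s`-subsets avoiding `k`
given points, where `s = r - k`. -/
theorem choose_le_div_pow_mul {c : ℝ} (hc : c < 1) {n k r j : ℕ} (hk : 1 ≤ k)
    (hkr : k < r) (hr : (r : ℝ) ≤ c * n) (hj : j ≤ k) :
    (n.choose (r - k + j) : ℝ) ≤
      ((k : ℝ) / (1 - c)) ^ k * ((n : ℝ) ^ j / (r : ℝ) ^ j) * ((n - k).choose (r - k) : ℝ) := by
  have hc' : 0 < 1 - c := by linarith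
  have hrn : (r : ℝ) ≤ n := hr.trans (by nlinarith [(Nat.cast_nonneg n : (0 : ℝ) ≤ n)])
  have hrn' : r ≤ n := by exact_mod_cast hrn
  have hr0 : (0 : ℝ) < r := by exact_mod_cast (by omega : 0 < r)
  have h1 := one_sub_pow_mul_choose_le (n := n) (k := k) (s := r - k) hc.le (by omega)
    (by rw [Nat.cast_sub hkr.le]; linarith)
  have h2 : (n.choose (r - k + j) : ℝ) * ((r - k : ℕ) + 1 : ℝ) ^ j ≤
      (n : ℝ) ^ j * (n.choose (r - k) : ℝ) := by
    exact_mod_cast choose_add_mul_succ_pow_le n (r - k) j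
  have h3 : (r : ℝ) ≤ k * ((r - k : ℕ) + 1 : ℝ) := by
    have h4 : r ≤ k * (r - k + 1) := by
      obtain ⟨d, rfl⟩ := Nat.exists_eq_add_of_lt hkr
      have : k + d + 1 - k = d + 1 := by omega
      rw [this]; nlinarith
    exact_mod_cast h4
  have hk1 : (1 : ℝ) ≤ k := by exact_mod_cast hk
  have h5 : (n.choose (r - k + j) : ℝ) * (r : ℝ) ^ j ≤
      (k : ℝ) ^ k * ((n : ℝ) ^ j * (n.choose (r - k) : ℝ)) := by
    calc (n.choose (r - k + j) : ℝ) * (r : ℝ) ^ j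
        ≤ (n.choose (r - k + j) : ℝ) * (k * ((r - k : ℕ) + 1 : ℝ)) ^ j := by gcongr
      _ = (k : ℝ) ^ j * ((n.choose (r - k + j) : ℝ) * ((r - k : ℕ) + 1 : ℝ) ^ j) := by
          rw [mul_pow]; ring
      _ ≤ (k : ℝ) ^ k * ((n : ℝ) ^ j * (n.choose (r - k) : ℝ)) := by gcongr
  have h6 : (n.choose (r - k) : ℝ) ≤ ((n - k).choose (r - k) : ℝ) / (1 - c) ^ k := by
    rw [le_div_iff₀ (by positivity)]; linarith
  have h7 : (n.choose (r - k + j) : ℝ) ≤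
      (k : ℝ) ^ k * ((n : ℝ) ^ j * (n.choose (r - k) : ℝ)) / (r : ℝ) ^ j := by
    rw [le_div_iff₀ (by positivity)]; exact h5
  refine h7.trans ?_
  calc (k : ℝ) ^ k * ((n : ℝ) ^ j * (n.choose (r - k) : ℝ)) / (r : ℝ) ^ j
      ≤ (k : ℝ) ^ k * ((n : ℝ) ^ j * (((n - k).choose (r - k) : ℝ) / (1 - c) ^ k)) /
          (r : ℝ) ^ j := by gcongr
    _ = _ := by rw [div_pow]; ring

/-! ### The bound as a function of `r` -/

/-- `t = n ^ (1 / (k + 1))` turns the fractional powers of `n` into natural powers of `t`. -/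
theorem exists_pow_succ_eq_and_rpow_eq (n k : ℕ) :
    ∃ t : ℝ, 0 ≤ t ∧ (n : ℝ) = t ^ (k + 1) ∧
      (n : ℝ) ^ ((k : ℝ) / ((k : ℝ) + 1)) = t ^ k := by
  refine ⟨(n : ℝ) ^ ((1 : ℝ) / ((k : ℝ) + 1)), by positivity, ?_, ?_⟩
  · rw [← Real.rpow_mul_natCast (by positivity)]
    push_cast
    rw [one_div, inv_mul_cancel₀ (by positivity), Real.rpow_one]
  · rw [← Real.rpow_mul_natCast (by positivity)]
    congr 1; ring

theorem rpow_le_kDistinctnessBound (k : ℕ) (hk : 1 ≤ k) (n r : ℕ) (hr : 1 ≤ r) :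
    (n : ℝ) ^ ((k : ℝ) / ((k : ℝ) + 1)) ≤ kDistinctnessBound n k r := by
  obtain ⟨t, ht, hn, hp⟩ := exists_pow_succ_eq_and_rpow_eq n k
  have hr0 : (0 : ℝ) < r := by exact_mod_cast hr
  rw [hp, kDistinctnessBound]
  rcases le_total (t ^ k) r with h | h
  · exact h.trans (le_add_of_nonneg_right (Finset.sum_nonneg fun _ _ => Real.sqrt_nonneg _))
  -- For small `r` the last term alone is large enough.
  · have h1 : t ^ k ≤ √((n : ℝ) ^ k / (r : ℝ) ^ (k - 1)) := by
      apply Real.le_sqrt_of_sq_le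
      rw [le_div_iff₀ (by positivity), hn]
      calc (t ^ k) ^ 2 * (r : ℝ) ^ (k - 1) ≤ (t ^ k) ^ 2 * (t ^ k) ^ (k - 1) := by gcongr
        _ = (t ^ (k + 1)) ^ k := by
          obtain ⟨l, rfl⟩ : ∃ l, k = l + 1 := ⟨k - 1, by omega⟩
          rw [Nat.add_sub_cancel]; ring
    have h2 := Finset.single_le_sum (f := fun j => √((n : ℝ) ^ j / (r : ℝ) ^ (j - 1)))
      (fun _ _ => Real.sqrt_nonneg _) (Finset.mem_Icc.2 ⟨hk, le_rfl⟩)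
    have h3 := h1.trans h2
    linarith

theorem kDistinctnessBound_le {k n r : ℕ} {t : ℝ} (ht : 1 ≤ t) (hn : (n : ℝ) = t ^ (k + 1))
    (hr : t ^ k ≤ r) (hr' : (r : ℝ) ≤ 2 * t ^ k) :
    kDistinctnessBound n k r ≤ ((k : ℝ) + 2) * t ^ k := by
  have h0 : (0 : ℝ) < t ^ k := by positivity
  have h1 : ∀ j ∈ Finset.Icc 1 k, √((n : ℝ) ^ j / (r : ℝ) ^ (j - 1)) ≤ t ^ k := by
    intro j hj
    rw [Finset.mem_Icc] at hj
    rw [Real.sqrt_le_left h0.le, div_le_iff₀ (pow_pos (h0.trans_le hr) _), hn]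
    calc (t ^ (k + 1)) ^ j = t ^ (j + k * j) := by ring
      _ ≤ t ^ (k + k * j) := pow_le_pow_right₀ ht (by omega)
      _ = (t ^ k) ^ 2 * (t ^ k) ^ (j - 1) := by
        obtain ⟨l, rfl⟩ : ∃ l, j = l + 1 := ⟨j - 1, by omega⟩
        rw [Nat.add_sub_cancel]; ring
      _ ≤ (t ^ k) ^ 2 * (r : ℝ) ^ (j - 1) := by gcongr
  have h2 := Finset.sum_le_sum h1
  rw [Finset.sum_const, Nat.card_Icc, nsmul_eq_mul, Nat.add_sub_cancel] at h2
  rw [kDistinctnessBound]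
  linarith

/-- For large `n` the choice `r = ⌈n ^ (k / (k + 1))⌉` lies strictly between `k` and `n / 2`. -/
theorem ceil_rpow_bounds {k n r : ℕ} (hk : 1 ≤ k) (hn : (k + 4) ^ (k + 1) ≤ n)
    (hr : r = ⌈(n : ℝ) ^ ((k : ℝ) / ((k : ℝ) + 1))⌉₊) :
    k < r ∧ (r : ℝ) ≤ 1 / 2 * n ∧
      kDistinctnessBound n k r ≤ ((k : ℝ) + 2) * (n : ℝ) ^ ((k : ℝ) / ((k : ℝ) + 1)) := by
  obtain ⟨t, ht, hnt, hp⟩ := exists_pow_succ_eq_and_rpow_eq n k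
  rw [hp] at hr ⊢
  have h4 : (k : ℝ) + 4 ≤ t := by
    refine le_of_pow_le_pow_left₀ (Nat.succ_ne_zero k) ht ?_
    rw [Nat.succ_eq_add_one, ← hnt]; exact_mod_cast hn
  have hk0 : (1 : ℝ) ≤ k := by exact_mod_cast hk
  have h1 : t ^ 1 ≤ t ^ k := pow_le_pow_right₀ (by linarith) hk
  rw [pow_one] at h1
  have h2 : t ^ k ≤ r := hr ▸ Nat.le_ceil _
  have h3 : (r : ℝ) ≤ 2 * t ^ k := by
    have := Nat.ceil_lt_add_one (show 0 ≤ t ^ k by positivity)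
    rw [← hr] at this; linarith
  refine ⟨?_, ?_, kDistinctnessBound_le (by linarith) hnt h2 h3⟩
  · have : (k : ℝ) < r := by linarith
    exact_mod_cast this
  · rw [hnt, pow_succ]; nlinarith

/-! ### The stages -/

theorem mem_kDistinctnessStage_one {n k r : ℕ} {e : Transition n} :
    e ∈ kDistinctnessStage n k r 1 ↔ e.1 = ∅ ∧ e.2.card = r - k := by
  simp [kDistinctnessStage]

theorem mem_kDistinctnessStage_add_two {n k r j : ℕ} {e : Transition n} :
    e ∈ kDistinctnessStage n k r (j + 2) ↔
      e.1.card = r - k + j ∧ e.1 ⊆ e.2 ∧ e.2.card = e.1.card + 1 := by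
  simp [kDistinctnessStage]

/-- The number of the stage that `e` belongs to, read off from the cardinality of its source. -/
def stageNumber {n : ℕ} (k r : ℕ) (e : Transition n) : ℕ :=
  if e.1 = ∅ then 1 else e.1.card - (r - k) + 2

theorem stageNumber_eq {n k r i : ℕ} (hkr : k < r) {e : Transition n}
    (he : e ∈ kDistinctnessStage n k r i) : stageNumber k r e = i := by
  match i with
  | 0 => simp [kDistinctnessStage] at he
  | 1 => rw [mem_kDistinctnessStage_one] at he; simp [stageNumber, he.1]
  | j + 2 =>
    rw [mem_kDistinctnessStage_add_two] at he
    have : e.1 ≠ ∅ := by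
      intro h; rw [h, Finset.card_empty] at he; omega
    rw [stageNumber, if_neg this]; omega

theorem card_snd_of_mem_stage {n k r i : ℕ} {e : Transition n}
    (he : e ∈ kDistinctnessStage n k r (i + 1)) : e.2.card = r - k + i := by
  cases i with
  | zero => exact (mem_kDistinctnessStage_one.1 he).2
  | succ j => rw [mem_kDistinctnessStage_add_two] at he; omega

theorem act_mem_stage {n k r i : ℕ} (g : Equiv.Perm (Fin n)) {e : Transition n}
    (he : e ∈ kDistinctnessStage n k r i) :
    Transition.act g e ∈ kDistinctnessStage n k r i := by
  match i with
  | 0 => simp [kDistinctnessStage] at he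
  | 1 =>
    rw [mem_kDistinctnessStage_one] at he ⊢
    simp [Transition.act, he.1, he.2]
  | j + 2 =>
    rw [mem_kDistinctnessStage_add_two] at he ⊢
    simpa [Transition.act] using he

theorem exists_perm_map_eq {n : ℕ} {S T : Finset (Fin n)} (h : S.card = T.card) :
    ∃ g : Equiv.Perm (Fin n), S.map g.toEmbedding = T := by
  let φ : {x // x ∈ S} ≃ {x // x ∈ T} := Finset.equivOfCardEq h
  refine ⟨φ.extendSubtype, Finset.eq_of_subset_of_card_le ?_ (by simp [h])⟩
  intro y hy
  obtain ⟨x, hx, rfl⟩ := Finset.mem_map.1 hy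
  exact φ.extendSubtype_mem x hx

theorem exists_notMem_eq_insert {α : Type*} [DecidableEq α] {S T : Finset α} (h : S ⊆ T)
    (hc : T.card = S.card + 1) : ∃ b ∉ S, T = insert b S := by
  have h1 : (T \ S).card = 1 := by rw [Finset.card_sdiff_of_subset h]; omega
  obtain ⟨b, hb⟩ := Finset.card_eq_one.1 h1
  have hbm : b ∈ T \ S := by simp [hb]
  refine ⟨b, (Finset.mem_sdiff.1 hbm).2, ?_⟩
  rw [← Finset.sdiff_union_of_subset h, hb]; rfl

/-- The symmetric group acts transitively on each stage. -/
theorem exists_act_eq {n k r i : ℕ} {e e' : Transition n}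
    (he : e ∈ kDistinctnessStage n k r i) (he' : e' ∈ kDistinctnessStage n k r i) :
    ∃ g : Equiv.Perm (Fin n), Transition.act g e = e' := by
  match i with
  | 0 => simp [kDistinctnessStage] at he
  | 1 =>
    rw [mem_kDistinctnessStage_one] at he he'
    obtain ⟨g, hg⟩ := exists_perm_map_eq (he.2.trans he'.2.symm)
    exact ⟨g, Prod.ext (by simp [Transition.act, he.1, he'.1]) hg⟩
  | j + 2 =>
    rw [mem_kDistinctnessStage_add_two] at he he'
    obtain ⟨S, T⟩ := e
    obtain ⟨S', T'⟩ := e'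
    dsimp only at he he'
    obtain ⟨b, hb, rfl⟩ := exists_notMem_eq_insert he.2.1 he.2.2
    obtain ⟨b', hb', rfl⟩ := exists_notMem_eq_insert he'.2.1 he'.2.2
    obtain ⟨g, rfl⟩ := exists_perm_map_eq (he.1.trans he'.1.symm)
    have hgb : g b ∉ S.map g.toEmbedding := by simpa using hb
    -- The added element is moved to its place by a transposition that fixes the image of `S`.
    have hfix : S.map (g.trans (Equiv.swap (g b) b')).toEmbedding = S.map g.toEmbedding := by
      rw [Finset.map_eq_image, Finset.map_eq_image]
      refine Finset.image_congr fun x hx => ?_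
      have hx' : g x ∈ S.map g.toEmbedding := by simpa using hx
      exact Equiv.swap_apply_of_ne_of_ne (fun h => hgb (h ▸ hx')) (fun h => hb' (h ▸ hx'))
    refine ⟨g.trans (Equiv.swap (g b) b'), ?_⟩
    simp only [Transition.act, Finset.map_insert, hfix]
    simp

/-! ### The numbers of transitions and of valid transitions -/

theorem card_stage_one_le (n k r : ℕ) :
    (kDistinctnessStage n k r 1).card ≤ n.choose (r - k) := by
  calc (kDistinctnessStage n k r 1).card
      ≤ ((Finset.powersetCard (r - k) (Finset.univ : Finset (Fin n))).image
          fun T => ((∅, T) : Transition n)).card := by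
        refine Finset.card_le_card fun e he => ?_
        rw [mem_kDistinctnessStage_one] at he
        refine Finset.mem_image.2 ⟨e.2, by simp [he.2], Prod.ext he.1.symm rfl⟩
    _ ≤ _ := Finset.card_image_le
    _ = _ := by simp

theorem card_stage_add_two_le (n k r j : ℕ) :
    (kDistinctnessStage n k r (j + 2)).card ≤ n * n.choose (r - k + j) := by
  calc (kDistinctnessStage n k r (j + 2)).card
      ≤ (((Finset.univ : Finset (Fin n)) ×ˢ
          (Finset.powersetCard (r - k + j) (Finset.univ : Finset (Fin n)))).image
          fun q => ((q.2, insert q.1 q.2) : Transition n)).card := by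
        refine Finset.card_le_card fun e he => ?_
        rw [mem_kDistinctnessStage_add_two] at he
        obtain ⟨b, -, hb⟩ := exists_notMem_eq_insert he.2.1 he.2.2
        exact Finset.mem_image.2 ⟨(b, e.1), by simp [he.1], Prod.ext rfl hb.symm⟩
    _ ≤ _ := Finset.card_image_le
    _ = _ := by simp

/-- The first `j` marked elements. -/
def markedBelow {n k : ℕ} (a : Fin k → Fin n) (j : ℕ) : Finset (Fin n) :=
  (Finset.univ.filter fun i : Fin k => (i : ℕ) < j).image a

theorem apply_mem_markedBelow {n k : ℕ} {a : Fin k → Fin n} (ha : Function.Injective a) {j : ℕ}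
    {i : Fin k} : a i ∈ markedBelow a j ↔ (i : ℕ) < j := by
  simp [markedBelow, ha.eq_iff]

theorem mem_markedBelow {n k : ℕ} {a : Fin k → Fin n} {j : ℕ} {b : Fin n} :
    b ∈ markedBelow a j ↔ ∃ i : Fin k, (i : ℕ) < j ∧ a i = b := by
  simp [markedBelow]

theorem card_markedBelow {n k : ℕ} {a : Fin k → Fin n} (ha : Function.Injective a) {j : ℕ}
    (hj : j ≤ k) : (markedBelow a j).card = j := by
  rw [markedBelow, Finset.card_image_of_injective _ ha, Fin.card_filter_val_lt]
  omega

open Classical in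
/-- On every stage, a valid transition is determined by its non-marked elements, and these may be
any `r - k` of the `n - k` non-marked positions. -/
theorem card_filter_valid {n k r i : ℕ} {a : Fin k → Fin n} (ha : Function.Injective a)
    (hi : i ∈ Finset.Icc 1 (k + 1)) :
    ((kDistinctnessStage n k r i).filter (KDistinctnessValid a i)).card =
      (n - k).choose (r - k) := by
  have hcompl : (markedBelow a k)ᶜ.card = n - k := by
    rw [Finset.card_compl, card_markedBelow ha le_rfl, Fintype.card_fin]
  have hmem : ∀ {T : Finset (Fin n)}, T ⊆ (markedBelow a k)ᶜ ↔ ∀ i, a i ∉ T := by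
    intro T
    constructor
    · intro h i hiT
      exact Finset.mem_compl.1 (h hiT) ((apply_mem_markedBelow ha).2 i.2)
    · intro h b hb
      rw [Finset.mem_compl, mem_markedBelow]
      rintro ⟨i, -, rfl⟩
      exact h i hb
  rw [← hcompl, ← Finset.card_powersetCard]
  symm
  match i with
  | 0 => simp at hi
  | 1 =>
    refine Finset.card_bij (fun T _ => ((∅, T) : Transition n)) ?_ ?_ ?_
    · intro T hT
      rw [Finset.mem_powersetCard, hmem] at hT
      rw [Finset.mem_filter, mem_kDistinctnessStage_one]
      exact ⟨⟨rfl, hT.2⟩, hT.1⟩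
    · intro T _ T' _ h
      exact congrArg Prod.snd h
    · intro e he
      rw [Finset.mem_filter, mem_kDistinctnessStage_one] at he
      exact ⟨e.2, Finset.mem_powersetCard.2 ⟨hmem.2 he.2, he.1.2⟩, Prod.ext he.1.1.symm rfl⟩
  | j + 2 =>
    have hj : j < k := by rw [Finset.mem_Icc] at hi; omega
    have hdisj : ∀ {T : Finset (Fin n)}, (∀ i, a i ∉ T) → Disjoint T (markedBelow a j) := by
      intro T h
      rw [Finset.disjoint_left]
      intro b hb hb'
      obtain ⟨i, -, rfl⟩ := mem_markedBelow.1 hb'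
      exact h i hb
    refine Finset.card_bij (fun T _ =>
      ((T ∪ markedBelow a j, insert (a ⟨j, hj⟩) (T ∪ markedBelow a j)) : Transition n)) ?_ ?_ ?_
    · intro T hT
      rw [Finset.mem_powersetCard, hmem] at hT
      have hin : ∀ i : Fin k, a i ∈ T ∪ markedBelow a j ↔ (i : ℕ) < j := by
        intro i
        rw [Finset.mem_union, apply_mem_markedBelow ha]
        simp [hT.1 i]
      rw [Finset.mem_filter, mem_kDistinctnessStage_add_two]
      refine ⟨⟨?_, Finset.subset_insert _ _, ?_⟩, hin, ⟨j, hj⟩, rfl, rfl⟩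
      · rw [Finset.card_union_of_disjoint (hdisj hT.1), card_markedBelow ha hj.le, hT.2]
      · apply Finset.card_insert_of_notMem
        rw [hin]; simp
    · intro T hT T' hT' h
      rw [Finset.mem_powersetCard, hmem] at hT hT'
      have h1 : T ∪ markedBelow a j = T' ∪ markedBelow a j := congrArg Prod.fst h
      rw [← Finset.union_sdiff_cancel_right (hdisj hT.1), h1,
        Finset.union_sdiff_cancel_right (hdisj hT'.1)]
    · intro e he
      rw [Finset.mem_filter, mem_kDistinctnessStage_add_two] at he
      obtain ⟨⟨hcard, -, -⟩, hval, i, hij, he2⟩ := he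
      have hi' : i = ⟨j, hj⟩ := Fin.ext hij
      have hsub : markedBelow a j ⊆ e.1 := by
        intro b hb
        obtain ⟨i, hij, rfl⟩ := mem_markedBelow.1 hb
        exact (hval i).2 hij
      have hun : e.1 \ markedBelow a j ∪ markedBelow a j = e.1 :=
        Finset.sdiff_union_of_subset hsub
      refine ⟨e.1 \ markedBelow a j, ?_, ?_⟩
      · rw [Finset.mem_powersetCard, hmem, Finset.card_sdiff_of_subset hsub, hcard,
          card_markedBelow ha hj.le]
        refine ⟨fun i => ?_, by omega⟩
        rw [Finset.mem_sdiff, hval, apply_mem_markedBelow ha]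
        tauto
      · exact Prod.ext hun (by rw [hun, he2, hi'])

/-! ### The graph -/

/-- The transitions of all the stages `1, …, k + 1`. -/
def kDistinctnessTransitions (n k r : ℕ) : Finset (Transition n) :=
  (Finset.Icc 1 (k + 1)).biUnion (kDistinctnessStage n k r)

theorem mem_kDistinctnessTransitions {n k r : ℕ} {e : Transition n} :
    e ∈ kDistinctnessTransitions n k r ↔
      ∃ i ∈ Finset.Icc 1 (k + 1), e ∈ kDistinctnessStage n k r i := by
  simp [kDistinctnessTransitions]

theorem sum_kDistinctnessTransitions {n k r : ℕ} (hkr : k < r) (F : Transition n → ℝ) :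
    ∑ e ∈ kDistinctnessTransitions n k r, F e =
      ∑ i ∈ Finset.Icc 1 (k + 1), ∑ e ∈ kDistinctnessStage n k r i, F e := by
  refine Finset.sum_biUnion fun i _ i' _ hii => ?_
  rw [Function.onFun, Finset.disjoint_left]
  intro e he he'
  exact hii ((stageNumber_eq hkr he).symm.trans (stageNumber_eq hkr he'))

theorem reflTransGen_kDistinctnessTransitions {n k r : ℕ} {j : ℕ} (hj : j ≤ k)
    {S : Finset (Fin n)} (hS : S.card = r - k + j) :
    Relation.ReflTransGen (fun S S' => (S, S') ∈ kDistinctnessTransitions n k r) ∅ S := by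
  induction j generalizing S with
  | zero =>
    exact Relation.ReflTransGen.single (mem_kDistinctnessTransitions.2
      ⟨1, by simp, mem_kDistinctnessStage_one.2 ⟨rfl, hS⟩⟩)
  | succ j ih =>
    obtain ⟨b, hb⟩ : S.Nonempty := by rw [← Finset.card_pos]; omega
    have hc := Finset.card_erase_add_one hb
    refine (ih (S := S.erase b) (by omega) (by omega)).tail (mem_kDistinctnessTransitions.2
      ⟨j + 2, by simp; omega, mem_kDistinctnessStage_add_two.2 ⟨?_, ?_, ?_⟩⟩)
    · dsimp only; omega
    · exact Finset.erase_subset _ _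
    · exact hc.symm

/-- The learning graph formed by the stages `1, …, k + 1`. -/
def kDistinctnessGraph (n : ℕ) {k r : ℕ} (hkr : k < r) : LearningGraph n where
  transitions := kDistinctnessTransitions n k r
  ssubset e he := by
    obtain ⟨i, hi, he⟩ := mem_kDistinctnessTransitions.1 he
    match i with
    | 0 => simp at hi
    | 1 =>
      rw [mem_kDistinctnessStage_one] at he
      rw [he.1, Finset.empty_ssubset, ← Finset.card_pos]
      omega
    | j + 2 =>
      rw [mem_kDistinctnessStage_add_two] at he
      refine he.2.1.ssubset_of_ne fun h => ?_
      have := congrArg Finset.card h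
      omega
  connected e he := by
    obtain ⟨i, hi, he⟩ := mem_kDistinctnessTransitions.1 he
    match i with
    | 0 => simp at hi
    | 1 => rw [(mem_kDistinctnessStage_one.1 he).1]
    | j + 2 =>
      refine reflTransGen_kDistinctnessTransitions (j := j) ?_
        (mem_kDistinctnessStage_add_two.1 he).1
      rw [Finset.mem_Icc] at hi; omega

theorem mem_reach_kDistinctnessGraph {n k r : ℕ} (hkr : k < r) {d : ℕ} {S : Finset (Fin n)} :
    S ∈ (kDistinctnessGraph n hkr).reach d ↔
      (d = 0 ∧ S = ∅) ∨ ∃ j, j ≤ k ∧ d = j + 1 ∧ S.card = r - k + j := by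
  induction d generalizing S with
  | zero => simp [LearningGraph.reach]
  | succ d ih =>
    simp only [LearningGraph.reach, Finset.mem_image, Finset.mem_filter]
    constructor
    · rintro ⟨e, ⟨he, hd⟩, rfl⟩
      right
      obtain ⟨i, hi, he⟩ := mem_kDistinctnessTransitions.1 he
      rw [Finset.mem_Icc] at hi
      match i with
      | 0 => omega
      | 1 =>
        rw [mem_kDistinctnessStage_one] at he
        rw [ih, he.1, Finset.card_empty] at hd
        refine ⟨0, by omega, ?_, by omega⟩
        rcases hd with hd | ⟨j, _, _, _⟩ <;> omega
      | j + 2 =>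
        rw [mem_kDistinctnessStage_add_two] at he
        rw [ih] at hd
        refine ⟨j + 1, by omega, ?_, by omega⟩
        rcases hd with ⟨-, hd⟩ | ⟨j, _, _, _⟩
        · rw [hd, Finset.card_empty] at he; omega
        · omega
    · rintro (⟨h, -⟩ | ⟨j, hj, hd, hS⟩)
      · omega
      · obtain rfl : d = j := by omega
        cases d with
        | zero =>
          exact ⟨(∅, S), ⟨mem_kDistinctnessTransitions.2
            ⟨1, by simp, mem_kDistinctnessStage_one.2 ⟨rfl, hS⟩⟩, ih.2 (Or.inl ⟨rfl, rfl⟩)⟩, rfl⟩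
        | succ j =>
          obtain ⟨b, hb⟩ : S.Nonempty := by rw [← Finset.card_pos]; omega
          have hc := Finset.card_erase_add_one hb
          refine ⟨(S.erase b, S), ⟨mem_kDistinctnessTransitions.2 ⟨j + 2, by simp; omega,
            mem_kDistinctnessStage_add_two.2 ⟨?_, Finset.erase_subset _ _, hc.symm⟩⟩,
            ih.2 (Or.inr ⟨j, by omega, rfl, ?_⟩)⟩, rfl⟩
          · dsimp only; omega
          · dsimp only; omega

theorem distance_kDistinctnessGraph_empty {n k r : ℕ} (hkr : k < r) :
    (kDistinctnessGraph n hkr).distance ∅ = 0 := by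
  rw [LearningGraph.distance, Nat.sInf_eq_zero]
  left
  exact (mem_reach_kDistinctnessGraph hkr).2 (Or.inl ⟨rfl, rfl⟩)

theorem distance_kDistinctnessGraph {n k r j : ℕ} (hkr : k < r) (hj : j ≤ k)
    {S : Finset (Fin n)} (hS : S.card = r - k + j) :
    (kDistinctnessGraph n hkr).distance S = j + 1 := by
  have : {d | S ∈ (kDistinctnessGraph n hkr).reach d} = {j + 1} := by
    ext d
    rw [Set.mem_ofPred_eq, mem_reach_kDistinctnessGraph, Set.mem_singleton_iff]
    constructor
    · rintro (⟨-, h⟩ | ⟨j', _, _, _⟩)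
      · rw [h, Finset.card_empty] at hS; omega
      · omega
    · rintro rfl
      exact Or.inr ⟨j, hj, rfl, hS⟩
  rw [LearningGraph.distance, this, csInf_singleton]

theorem stage_kDistinctnessGraph {n k r i : ℕ} (hkr : k < r) (hi : i ∈ Finset.Icc 1 (k + 1)) :
    (kDistinctnessGraph n hkr).stage i = kDistinctnessStage n k r i := by
  have hsnd : ∀ i ∈ Finset.Icc 1 (k + 1), ∀ e ∈ kDistinctnessStage n k r i,
      (kDistinctnessGraph n hkr).distance e.2 = i := by
    intro i hi e he
    obtain ⟨j, rfl⟩ : ∃ j, i = j + 1 := ⟨i - 1, by rw [Finset.mem_Icc] at hi; omega⟩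
    refine distance_kDistinctnessGraph hkr ?_ (card_snd_of_mem_stage he)
    rw [Finset.mem_Icc] at hi; omega
  ext e
  rw [LearningGraph.stage, Finset.mem_filter]
  constructor
  · rintro ⟨he, -, h⟩
    obtain ⟨i', hi', he⟩ := mem_kDistinctnessTransitions.1 he
    rwa [← h, hsnd i' hi' e he]
  · intro he
    refine ⟨mem_kDistinctnessTransitions.2 ⟨i, hi, he⟩, ?_, hsnd i hi e he⟩
    rw [Finset.mem_Icc] at hi
    match i with
    | 0 => omega
    | 1 => rw [(mem_kDistinctnessStage_one.1 he).1, distance_kDistinctnessGraph_empty]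
    | j + 2 =>
      rw [distance_kDistinctnessGraph hkr (by omega) (mem_kDistinctnessStage_add_two.1 he).1]

/-- The equivalence classes of transitions are the stages. -/
theorem equivClass_kDistinctnessGraph {n k r i : ℕ} (hkr : k < r)
    (hi : i ∈ Finset.Icc 1 (k + 1)) {e : Transition n} (he : e ∈ kDistinctnessStage n k r i) :
    (kDistinctnessGraph n hkr).equivClass e = kDistinctnessStage n k r i := by
  ext e'
  rw [LearningGraph.equivClass, Finset.mem_filter]
  constructor
  · rintro ⟨-, g, rfl⟩
    exact act_mem_stage g he
  · intro he'
    exact ⟨mem_kDistinctnessTransitions.2 ⟨i, hi, he'⟩, exists_act_eq he he'⟩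

/-! ### The flow -/

open Classical in
/-- The uniform flow through the valid transitions, for the marked elements `a`. -/
noncomputable def kDistinctnessFlow {n k : ℕ} (r : ℕ) (a : Fin k → Fin n)
    (e : Transition n) : ℝ :=
  if e ∈ kDistinctnessTransitions n k r ∧ KDistinctnessValid a (stageNumber k r e) e then
    ((n - k).choose (r - k) : ℝ)⁻¹ else 0

section Flow

variable {n k r : ℕ} {a : Fin k → Fin n}

theorem kDistinctnessFlow_of_valid (hkr : k < r) {i : ℕ} (hi : i ∈ Finset.Icc 1 (k + 1))
    {e : Transition n} (he : e ∈ kDistinctnessStage n k r i) (hv : KDistinctnessValid a i e) :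
    kDistinctnessFlow r a e = ((n - k).choose (r - k) : ℝ)⁻¹ := by
  rw [kDistinctnessFlow, stageNumber_eq hkr he,
    if_pos ⟨mem_kDistinctnessTransitions.2 ⟨i, hi, he⟩, hv⟩]

theorem kDistinctnessFlow_of_not_valid (hkr : k < r) {i : ℕ}
    {e : Transition n} (he : e ∈ kDistinctnessStage n k r i) (hv : ¬ KDistinctnessValid a i e) :
    kDistinctnessFlow r a e = 0 := by
  rw [kDistinctnessFlow, stageNumber_eq hkr he, if_neg fun h => hv h.2]

theorem kDistinctnessFlow_nonneg (e : Transition n) : 0 ≤ kDistinctnessFlow r a e := by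
  rw [kDistinctnessFlow]; split_ifs <;> positivity

theorem kDistinctnessFlow_of_notMem {e : Transition n} (he : e ∉ kDistinctnessTransitions n k r) :
    kDistinctnessFlow r a e = 0 := if_neg fun h => he h.1

theorem valid_of_kDistinctnessFlow_ne_zero (hkr : k < r) {e : Transition n}
    (he : kDistinctnessFlow r a e ≠ 0) :
    ∃ i ∈ Finset.Icc 1 (k + 1), e ∈ kDistinctnessStage n k r i ∧ KDistinctnessValid a i e := by
  by_cases h : e ∈ kDistinctnessTransitions n k r
  · obtain ⟨i, hi, hm⟩ := mem_kDistinctnessTransitions.1 h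
    exact ⟨i, hi, hm, by_contra fun hv => he (kDistinctnessFlow_of_not_valid hkr hm hv)⟩
  · exact absurd (kDistinctnessFlow_of_notMem h) he

theorem choose_sub_pos (n k r : ℕ) (hrn : r ≤ n) : (0 : ℝ) < ((n - k).choose (r - k) : ℝ) := by
  exact_mod_cast Nat.choose_pos (Nat.sub_le_sub_right hrn k)

theorem kDistinctnessFlow_pos_iff (hkr : k < r) (hrn : r ≤ n) {i : ℕ}
    (hi : i ∈ Finset.Icc 1 (k + 1)) {e : Transition n} (he : e ∈ kDistinctnessStage n k r i) :
    0 < kDistinctnessFlow r a e ↔ KDistinctnessValid a i e := by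
  constructor
  · intro h
    by_contra hv
    exact h.ne' (kDistinctnessFlow_of_not_valid hkr he hv)
  · intro hv
    rw [kDistinctnessFlow_of_valid hkr hi he hv]
    exact inv_pos.2 (choose_sub_pos n k r hrn)

/-- Every stage carries the whole unit of flow. -/
theorem sum_stage_kDistinctnessFlow (hkr : k < r) (hrn : r ≤ n) (ha : Function.Injective a)
    {i : ℕ} (hi : i ∈ Finset.Icc 1 (k + 1)) :
    ∑ e ∈ kDistinctnessStage n k r i, kDistinctnessFlow r a e = 1 := by
  classical
  rw [← Finset.sum_filter_add_sum_filter_not _ (KDistinctnessValid a i),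
    Finset.sum_congr rfl (g := fun _ => ((n - k).choose (r - k) : ℝ)⁻¹) fun e he => by
      rw [Finset.mem_filter] at he
      exact kDistinctnessFlow_of_valid hkr hi he.1 he.2,
    Finset.sum_eq_zero (s := Finset.filter (fun e => ¬ _) _) fun e he => by
      rw [Finset.mem_filter] at he
      exact kDistinctnessFlow_of_not_valid hkr he.1 he.2,
    Finset.sum_const, card_filter_valid ha hi, nsmul_eq_mul, add_zero]
  exact mul_inv_cancel₀ (choose_sub_pos n k r hrn).ne'

theorem sq_kDistinctnessFlow (e : Transition n) :
    kDistinctnessFlow r a e ^ 2 =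
      ((n - k).choose (r - k) : ℝ)⁻¹ * kDistinctnessFlow r a e := by
  rw [kDistinctnessFlow]; split_ifs <;> ring

open Classical in
/-- The flow leaving a vertex before the last layer: the vertex is used exactly when its marked
elements are the first `j`. -/
theorem outflow_kDistinctnessFlow (hkr : k < r) {j : ℕ} (hj : j < k) {S : Finset (Fin n)}
    (hS : S.card = r - k + j) :
    (kDistinctnessGraph n hkr).outflow (kDistinctnessFlow r a) S =
      if ∀ i : Fin k, a i ∈ S ↔ (i : ℕ) < j then ((n - k).choose (r - k) : ℝ)⁻¹ else 0 := by
  have key : ∀ e : Transition n, e.1 = S → kDistinctnessFlow r a e ≠ 0 →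
      (∀ i : Fin k, a i ∈ S ↔ (i : ℕ) < j) ∧ e = (S, insert (a ⟨j, hj⟩) S) := by
    rintro e rfl he
    obtain ⟨i, hi, hm, hv⟩ := valid_of_kDistinctnessFlow_ne_zero hkr he
    match i with
    | 0 => simp at hi
    | 1 => rw [(mem_kDistinctnessStage_one.1 hm).1, Finset.card_empty] at hS; omega
    | j' + 2 =>
      rw [mem_kDistinctnessStage_add_two] at hm
      obtain rfl : j' = j := by omega
      obtain ⟨hv1, i, hij, hv2⟩ := hv
      obtain rfl : i = ⟨j', hj⟩ := Fin.ext hij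
      exact ⟨hv1, Prod.ext rfl hv2⟩
  rw [LearningGraph.outflow]
  split_ifs with h
  · have hnot : a ⟨j, hj⟩ ∉ S := by rw [h]; simp
    have hi : j + 2 ∈ Finset.Icc 1 (k + 1) := by simp; omega
    have hmem : (S, insert (a ⟨j, hj⟩) S) ∈ kDistinctnessStage n k r (j + 2) :=
      mem_kDistinctnessStage_add_two.2
        ⟨hS, Finset.subset_insert _ _, Finset.card_insert_of_notMem hnot⟩
    rw [Finset.sum_eq_single (S, insert (a ⟨j, hj⟩) S)]
    · exact kDistinctnessFlow_of_valid hkr hi hmem ⟨h, ⟨j, hj⟩, rfl, rfl⟩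
    · intro e he hne
      by_contra h0
      exact hne (key e (Finset.mem_filter.1 he).2 h0).2
    · intro hn
      have hm : (S, insert (a ⟨j, hj⟩) S) ∈ (kDistinctnessGraph n hkr).transitions :=
        mem_kDistinctnessTransitions.2 ⟨_, hi, hmem⟩
      exact (hn (Finset.mem_filter.2 ⟨hm, rfl⟩)).elim
  · refine Finset.sum_eq_zero fun e he => ?_
    by_contra h0
    exact h (key e (Finset.mem_filter.1 he).2 h0).1

open Classical in
/-- The flow entering a vertex: again the vertex is used exactly when its marked elements are the
first `j`. -/
theorem inflow_kDistinctnessFlow (hkr : k < r) (ha : Function.Injective a) {j : ℕ} (hj : j ≤ k)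
    {S : Finset (Fin n)} (hS : S.card = r - k + j) :
    (kDistinctnessGraph n hkr).inflow (kDistinctnessFlow r a) S =
      if ∀ i : Fin k, a i ∈ S ↔ (i : ℕ) < j then ((n - k).choose (r - k) : ℝ)⁻¹ else 0 := by
  have hi : j + 1 ∈ Finset.Icc 1 (k + 1) := by simp; omega
  -- The only transition into `S` that may be valid.
  obtain ⟨e₀, he₀, huniq, hval⟩ : ∃ e₀ : Transition n, e₀.2 = S ∧
      (∀ e : Transition n, e.2 = S → kDistinctnessFlow r a e ≠ 0 →
        (∀ i : Fin k, a i ∈ S ↔ (i : ℕ) < j) ∧ e = e₀) ∧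
      ((∀ i : Fin k, a i ∈ S ↔ (i : ℕ) < j) →
        e₀ ∈ kDistinctnessStage n k r (j + 1) ∧ KDistinctnessValid a (j + 1) e₀) := by
    cases j with
    | zero =>
      refine ⟨(∅, S), rfl, ?_, fun h =>
        ⟨mem_kDistinctnessStage_one.2 ⟨rfl, hS⟩, fun i hi' => absurd ((h i).1 hi') (by simp)⟩⟩
      rintro e rfl he
      obtain ⟨i, hi, hm, hv⟩ := valid_of_kDistinctnessFlow_ne_zero hkr he
      match i with
      | 0 => simp at hi
      | 1 => exact ⟨fun i => by simpa using hv i, Prod.ext (mem_kDistinctnessStage_one.1 hm).1 rfl⟩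
      | j' + 2 => rw [mem_kDistinctnessStage_add_two] at hm; omega
    | succ j =>
      have hjk : j < k := hj
      refine ⟨(S.erase (a ⟨j, hjk⟩), S), rfl, ?_, fun h => ?_⟩
      · rintro e rfl he
        obtain ⟨i, hi, hm, hv⟩ := valid_of_kDistinctnessFlow_ne_zero hkr he
        match i with
        | 0 => simp at hi
        | 1 => rw [mem_kDistinctnessStage_one] at hm; omega
        | j' + 2 =>
          rw [mem_kDistinctnessStage_add_two] at hm
          obtain rfl : j' = j := by omega
          obtain ⟨hv1, i, hij, hv2⟩ := hv
          obtain rfl : i = ⟨j', hjk⟩ := Fin.ext hij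
          have hnot : a ⟨j', hjk⟩ ∉ e.1 := by rw [hv1]; simp
          refine ⟨fun i => ?_, Prod.ext ?_ rfl⟩
          · rw [hv2, Finset.mem_insert, ha.eq_iff, hv1, Fin.ext_iff]
            dsimp only; omega
          · rw [hv2, Finset.erase_insert hnot]
      · have hin : a ⟨j, hjk⟩ ∈ S := by rw [h]; simp
        have hc := Finset.card_erase_add_one hin
        refine ⟨mem_kDistinctnessStage_add_two.2 ⟨?_, Finset.erase_subset _ _, hc.symm⟩,
          fun i => ?_, ⟨j, hjk⟩, rfl, (Finset.insert_erase hin).symm⟩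
        · dsimp only; omega
        · rw [Finset.mem_erase, h, ha.ne_iff, Ne, Fin.ext_iff]
          dsimp only; omega
  rw [LearningGraph.inflow]
  split_ifs with h
  · rw [Finset.sum_eq_single e₀]
    · exact kDistinctnessFlow_of_valid hkr hi (hval h).1 (hval h).2
    · intro e he hne
      by_contra h0
      exact hne (huniq e (Finset.mem_filter.1 he).2 h0).2
    · intro hn
      exact absurd (Finset.mem_filter.2
        ⟨mem_kDistinctnessTransitions.2 ⟨_, hi, (hval h).1⟩, he₀⟩) hn
  · refine Finset.sum_eq_zero fun e he => ?_
    by_contra h0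
    exact h (huniq e (Finset.mem_filter.1 he).2 h0).1

theorem outflow_kDistinctnessFlow_empty (hkr : k < r) (hrn : r ≤ n)
    (ha : Function.Injective a) :
    (kDistinctnessGraph n hkr).outflow (kDistinctnessFlow r a) ∅ = 1 := by
  have h1 : 1 ∈ Finset.Icc 1 (k + 1) := by simp
  rw [← sum_stage_kDistinctnessFlow hkr hrn ha h1, LearningGraph.outflow]
  congr 1
  ext e
  rw [Finset.mem_filter]
  constructor
  · rintro ⟨he, h⟩
    obtain ⟨i, hi, he⟩ := mem_kDistinctnessTransitions.1 he
    rwa [← stageNumber_eq hkr he, stageNumber, if_pos h] at he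
  · intro he
    exact ⟨mem_kDistinctnessTransitions.2 ⟨1, h1, he⟩, (mem_kDistinctnessStage_one.1 he).1⟩

theorem containsOneCertificate_of_inflow_pos {m : ℕ} {x : Fin n → Fin m} (hkr : k < r)
    (hrn : r ≤ n) (ha : Function.Injective a) (hax : ∀ i j, x (a i) = x (a j))
    {S : Finset (Fin n)} (hS : ¬ ∃ e ∈ (kDistinctnessGraph n hkr).transitions, e.1 = S)
    (hpos : 0 < (kDistinctnessGraph n hkr).inflow (kDistinctnessFlow r a) S) :
    ContainsOneCertificate (kDistinctness n m k) x S := by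
  classical
  obtain ⟨e, he, rfl⟩ : ∃ e ∈ kDistinctnessTransitions n k r, e.2 = S := by
    by_contra! hno
    refine hpos.ne' (Finset.sum_eq_zero fun e he => ?_)
    rw [Finset.mem_filter] at he
    exact absurd he.2 (hno e he.1)
  obtain ⟨i, hi, he⟩ := mem_kDistinctnessTransitions.1 he
  rw [Finset.mem_Icc] at hi
  obtain ⟨j, rfl⟩ : ∃ j, i = j + 1 := ⟨i - 1, by omega⟩
  have hc := card_snd_of_mem_stage he
  -- Before the last layer there is still an element left to query, so `e.2` is in the last one.
  have hjk : j = k := by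
    by_contra hne
    obtain ⟨b, hb⟩ : ∃ b, b ∉ e.2 := by
      by_contra! hall
      have := congrArg Finset.card (Finset.eq_univ_iff_forall.2 hall)
      rw [Finset.card_univ, Fintype.card_fin] at this
      omega
    exact hS ⟨(e.2, insert b e.2), mem_kDistinctnessTransitions.2 ⟨j + 2, by simp; omega,
      mem_kDistinctnessStage_add_two.2 ⟨hc, Finset.subset_insert _ _,
        Finset.card_insert_of_notMem hb⟩⟩, rfl⟩
  rw [hjk] at hc
  rw [inflow_kDistinctnessFlow hkr ha le_rfl hc] at hpos
  have hall : ∀ i : Fin k, a i ∈ e.2 := by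
    by_contra hno
    rw [if_neg fun h => hno fun i => (h i).2 i.2] at hpos
    exact lt_irrefl _ hpos
  intro y hy
  rw [kDistinctness, decide_eq_true_iff]
  refine ⟨Finset.univ.image a, by rw [Finset.card_image_of_injective _ ha]; simp, ?_⟩
  simp only [Finset.mem_image, Finset.mem_univ, true_and]
  rintro _ ⟨i, rfl⟩ _ ⟨i', rfl⟩
  rw [hy _ (hall i), hy _ (hall i'), hax i i']

theorem isFlow_kDistinctnessFlow {m : ℕ} {x : Fin n → Fin m} (hkr : k < r)
    (hrn : r ≤ n) (ha : Function.Injective a) (hax : ∀ i j, x (a i) = x (a j)) :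
    (kDistinctnessGraph n hkr).IsFlow (kDistinctness n m k) x (kDistinctnessFlow r a) where
  nonneg e _ := kDistinctnessFlow_nonneg e
  support e he := kDistinctnessFlow_of_notMem he
  source := outflow_kDistinctnessFlow_empty hkr hrn ha
  conservation S hS := by
    rintro ⟨e, he, rfl⟩
    obtain ⟨i, hi, he⟩ := mem_kDistinctnessTransitions.1 he
    rw [Finset.mem_Icc] at hi
    match i with
    | 0 => omega
    | 1 => exact absurd (mem_kDistinctnessStage_one.1 he).1 hS
    | j + 2 =>
      have hc := (mem_kDistinctnessStage_add_two.1 he).1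
      rw [inflow_kDistinctnessFlow hkr ha (by omega) hc,
        outflow_kDistinctnessFlow hkr (by omega) hc]
  sink S hS hpos := containsOneCertificate_of_inflow_pos hkr hrn ha hax hS hpos

end Flow

/-! ### The weights and the complexity -/

/-- The learning graph with the uniform flow. On a stage with `N` transitions, of which `V` are
valid, all weights are `1 / √(N V)`; this makes the contributions of the stage to the negative and
to the positive complexity equal. -/
noncomputable def kDistinctnessGraphFor {n m k r : ℕ} (hkr : k < r) (hrn : r ≤ n)
    (a : (Fin n → Fin m) → Fin k → Fin n) (ha : IsMarking a) :
    LearningGraphFor (kDistinctness n m k) where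
  toLearningGraph := kDistinctnessGraph n hkr
  weight e := (√(kDistinctnessStage n k r (stageNumber k r e)).card *
    √((n - k).choose (r - k)))⁻¹
  weight_pos e he := by
    obtain ⟨i, -, he⟩ := mem_kDistinctnessTransitions.1 he
    rw [stageNumber_eq hkr he]
    have h1 : (0 : ℝ) < (kDistinctnessStage n k r i).card := by
      exact_mod_cast Finset.card_pos.2 ⟨e, he⟩
    have h2 := choose_sub_pos n k r hrn
    positivity
  flow x := kDistinctnessFlow r (a x)
  isFlow x hx := isFlow_kDistinctnessFlow hkr hrn (ha x hx).1 (ha x hx).2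

/-- The length of the transitions of stage `i`. -/
def stageLength (k r i : ℕ) : ℕ := if i = 1 then r - k else 1

theorem length_of_mem_stage {n k r i : ℕ} {e : Transition n}
    (he : e ∈ kDistinctnessStage n k r i) : e.length = stageLength k r i := by
  match i with
  | 0 => simp [kDistinctnessStage] at he
  | 1 =>
    rw [mem_kDistinctnessStage_one] at he
    simp [Transition.length, stageLength, he.1, he.2]
  | j + 2 =>
    rw [mem_kDistinctnessStage_add_two] at he
    rw [Transition.length, Finset.card_sdiff_of_subset he.2.1, he.2.2]
    simp [stageLength]

section GraphFor

variable {n m k r : ℕ} (hkr : k < r) (hrn : r ≤ n)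
  {a : (Fin n → Fin m) → Fin k → Fin n} (ha : IsMarking a)

theorem isKDistinctnessGraph_kDistinctnessGraphFor :
    IsKDistinctnessGraph r a (kDistinctnessGraphFor hkr hrn a ha) where
  transitions_eq := rfl
  stage_eq _ hi := stage_kDistinctnessGraph hkr hi
  flow_valid _ _ _ hi _ he hv := kDistinctnessFlow_of_valid hkr hi he hv
  flow_invalid _ _ _ _ _ he hv := kDistinctnessFlow_of_not_valid hkr he hv

theorem isInvariant_kDistinctnessGraphFor :
    (kDistinctnessGraphFor hkr hrn a ha).IsInvariant := by
  intro g e he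
  obtain ⟨i, hi, he⟩ := mem_kDistinctnessTransitions.1 he
  exact mem_kDistinctnessTransitions.2 ⟨i, hi, act_mem_stage g he⟩

theorem speciality_kDistinctnessGraphFor {x : Fin n → Fin m} (hx : kDistinctness n m k x = true)
    {i : ℕ} (hi : i ∈ Finset.Icc 1 (k + 1)) {e : Transition n}
    (he : e ∈ kDistinctnessStage n k r i) :
    (kDistinctnessGraphFor hkr hrn a ha).speciality x e =
      ((kDistinctnessStage n k r i).card : ℝ) / ((n - k).choose (r - k) : ℝ) := by
  classical
  have h1 : (kDistinctnessGraphFor hkr hrn a ha).equivClass e = kDistinctnessStage n k r i :=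
    equivClass_kDistinctnessGraph hkr hi he
  rw [LearningGraphFor.speciality, h1, ← card_filter_valid (ha x hx).1 hi]
  congr 3
  exact Finset.filter_congr fun e he => kDistinctnessFlow_pos_iff hkr hrn hi he

theorem isSymmetricOn_kDistinctnessGraphFor {i : ℕ} (hi : i ∈ Finset.Icc 1 (k + 1)) :
    (kDistinctnessGraphFor hkr hrn a ha).IsSymmetricOn i where
  flow_eq e he e' he' _ x x' _ _ hv hv' := by
    have hs : (kDistinctnessGraphFor hkr hrn a ha).stage i = kDistinctnessStage n k r i :=
      stage_kDistinctnessGraph hkr hi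
    rw [hs] at he he'
    exact (kDistinctnessFlow_of_valid hkr hi he
      ((kDistinctnessFlow_pos_iff hkr hrn hi he).1 hv)).trans
      (kDistinctnessFlow_of_valid hkr hi he'
        ((kDistinctnessFlow_pos_iff hkr hrn hi he').1 hv')).symm
  speciality_eq e he x x' hx hx' := by
    have hs : (kDistinctnessGraphFor hkr hrn a ha).stage i = kDistinctnessStage n k r i :=
      stage_kDistinctnessGraph hkr hi
    rw [hs] at he
    rw [speciality_kDistinctnessGraphFor hkr hrn ha hx hi he,
      speciality_kDistinctnessGraphFor hkr hrn ha hx' hi he]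

theorem averageLength_kDistinctnessGraphFor {x : Fin n → Fin m}
    (hx : kDistinctness n m k x = true) {i : ℕ} (hi : i ∈ Finset.Icc 1 (k + 1)) :
    (kDistinctnessGraphFor hkr hrn a ha).averageLength x i = stageLength k r i := by
  have hs : (kDistinctnessGraphFor hkr hrn a ha).stage i = kDistinctnessStage n k r i :=
    stage_kDistinctnessGraph hkr hi
  rw [LearningGraphFor.averageLength, hs, Finset.sum_congr rfl fun e he => by
    rw [length_of_mem_stage he], ← Finset.sum_mul]
  exact (congrArg (· * (stageLength k r i : ℝ))
    (sum_stage_kDistinctnessFlow hkr hrn (ha x hx).1 hi)).trans (one_mul _)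

/-- The complexity is at most the sum over the stages of the length times the square root of the
speciality. -/
theorem complexity_kDistinctnessGraphFor_le :
    (kDistinctnessGraphFor hkr hrn a ha).complexity ≤
      ∑ i ∈ Finset.Icc 1 (k + 1), (stageLength k r i : ℝ) *
        √((kDistinctnessStage n k r i).card / ((n - k).choose (r - k) : ℝ)) := by
  set Q := ∑ i ∈ Finset.Icc 1 (k + 1), (stageLength k r i : ℝ) *
        √((kDistinctnessStage n k r i).card / ((n - k).choose (r - k) : ℝ))
  have hQ0 : 0 ≤ Q := Finset.sum_nonneg fun _ _ => by positivity
  have hneg : (kDistinctnessGraphFor hkr hrn a ha).negativeComplexity = Q := by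
    refine (sum_kDistinctnessTransitions hkr _).trans (Finset.sum_congr rfl fun i hi => ?_)
    rw [Finset.sum_congr rfl (g := fun _ => (stageLength k r i : ℝ) *
      (√(kDistinctnessStage n k r i).card * √((n - k).choose (r - k)))⁻¹) fun e he => by
        rw [length_of_mem_stage he, kDistinctnessGraphFor]
        dsimp only
        rw [stageNumber_eq hkr he],
      Finset.sum_const, nsmul_eq_mul, Real.sqrt_div (by positivity), mul_inv]
    have h2 : ((kDistinctnessStage n k r i).card : ℝ) * (√(kDistinctnessStage n k r i).card)⁻¹ =
        √(kDistinctnessStage n k r i).card := by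
      rw [← div_eq_mul_inv, Real.div_sqrt]
    rw [div_eq_mul_inv]
    linear_combination (stageLength k r i : ℝ) * (√((n - k).choose (r - k)))⁻¹ * h2
  have hpos : (kDistinctnessGraphFor hkr hrn a ha).positiveComplexity ≤ Q := by
    refine Real.iSup_le (fun x => le_of_eq ?_) hQ0
    refine (sum_kDistinctnessTransitions hkr _).trans (Finset.sum_congr rfl fun i hi => ?_)
    rw [Finset.sum_congr rfl (g := fun e => (stageLength k r i : ℝ) *
      (√(kDistinctnessStage n k r i).card * √((n - k).choose (r - k))) *
        ((n - k).choose (r - k) : ℝ)⁻¹ * kDistinctnessFlow r (a x.1) e) fun e he => by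
        rw [length_of_mem_stage he, kDistinctnessGraphFor]
        dsimp only
        rw [stageNumber_eq hkr he, sq_kDistinctnessFlow, div_inv_eq_mul]
        ring,
      ← Finset.mul_sum, sum_stage_kDistinctnessFlow hkr hrn (ha x.1 x.2).1 hi,
      Real.sqrt_div (by positivity)]
    have h2 := Real.sqrt_div_self (x := ((n - k).choose (r - k) : ℝ))
    rw [div_eq_mul_inv] at h2 ⊢
    linear_combination (stageLength k r i : ℝ) * √(kDistinctnessStage n k r i).card * h2
  rw [LearningGraphFor.complexity, hneg]
  calc √(Q * _) ≤ √(Q * Q) := Real.sqrt_le_sqrt (mul_le_mul_of_nonneg_left hpos hQ0)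
    _ = Q := Real.sqrt_mul_self hQ0

end GraphFor

/-! ### The parameters for `r ≤ c n` -/

section Parameters

variable {c : ℝ} {n k r : ℕ}

theorem card_stage_one_div_le (hc : c < 1) (hk : 1 ≤ k) (hkr : k < r) (hr : (r : ℝ) ≤ c * n)
    (hrn : r ≤ n) :
    ((kDistinctnessStage n k r 1).card : ℝ) / ((n - k).choose (r - k) : ℝ) ≤
      ((k : ℝ) / (1 - c)) ^ k := by
  rw [div_le_iff₀ (choose_sub_pos n k r hrn)]
  have h1 := choose_le_div_pow_mul hc hk hkr hr (Nat.zero_le k)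
  simp only [pow_zero, div_one, mul_one, add_zero] at h1
  exact (Nat.cast_le.2 (card_stage_one_le n k r)).trans h1

theorem card_stage_add_two_div_le (hc : c < 1) (hk : 1 ≤ k) (hkr : k < r)
    (hr : (r : ℝ) ≤ c * n) (hrn : r ≤ n) {j : ℕ} (hj : j < k) :
    ((kDistinctnessStage n k r (j + 2)).card : ℝ) / ((n - k).choose (r - k) : ℝ) ≤
      ((k : ℝ) / (1 - c)) ^ k * ((n : ℝ) ^ (j + 1) / (r : ℝ) ^ j) := by
  rw [div_le_iff₀ (choose_sub_pos n k r hrn)]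
  have h1 := choose_le_div_pow_mul hc hk hkr hr hj.le
  have h2 : ((kDistinctnessStage n k r (j + 2)).card : ℝ) ≤ n * n.choose (r - k + j) := by
    exact_mod_cast card_stage_add_two_le n k r j
  calc ((kDistinctnessStage n k r (j + 2)).card : ℝ) ≤ n * n.choose (r - k + j) := h2
    _ ≤ n * (((k : ℝ) / (1 - c)) ^ k * ((n : ℝ) ^ j / (r : ℝ) ^ j) *
          ((n - k).choose (r - k) : ℝ)) := by gcongr
    _ = _ := by ring

theorem sum_Icc_one_add_one (F : ℕ → ℝ) (k : ℕ) :
    ∑ i ∈ Finset.Icc 1 (k + 1), F i = F 1 + ∑ j ∈ Finset.Icc 1 k, F (j + 1) := by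
  induction k with
  | zero => simp
  | succ k ih =>
    rw [Finset.sum_Icc_succ_top (by omega), ih, Finset.sum_Icc_succ_top (by omega)]
    ring

theorem complexity_kDistinctnessGraphFor_le_bound {m : ℕ} (hc0 : 0 ≤ c) (hc : c < 1) (hk : 1 ≤ k)
    (hkr : k < r) (hr : (r : ℝ) ≤ c * n) (hrn : r ≤ n)
    {a : (Fin n → Fin m) → Fin k → Fin n} (ha : IsMarking a) :
    (kDistinctnessGraphFor hkr hrn a ha).complexity ≤
      ((k : ℝ) / (1 - c)) ^ k * kDistinctnessBound n k r := by
  set C := ((k : ℝ) / (1 - c)) ^ k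
  have hC1 : 1 ≤ C := by
    apply one_le_pow₀
    rw [one_le_div (by linarith)]
    have : (1 : ℝ) ≤ k := by exact_mod_cast hk
    linarith
  have hsqrt : √C ≤ C := by
    rw [Real.sqrt_le_left (by linarith)]; nlinarith
  refine (complexity_kDistinctnessGraphFor_le hkr hrn ha).trans ?_
  rw [sum_Icc_one_add_one, kDistinctnessBound, mul_add, Finset.mul_sum]
  refine add_le_add ?_ (Finset.sum_le_sum fun j hj => ?_)
  · have h1 : (stageLength k r 1 : ℝ) ≤ r := by
      simp only [stageLength, if_true]; exact_mod_cast Nat.sub_le r k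
    have h2 := (Real.sqrt_le_sqrt (card_stage_one_div_le hc hk hkr hr hrn)).trans hsqrt
    rw [mul_comm C]
    gcongr
  · rw [Finset.mem_Icc] at hj
    obtain ⟨l, rfl⟩ : ∃ l, j = l + 1 := ⟨j - 1, by omega⟩
    have h2 := Real.sqrt_le_sqrt (card_stage_add_two_div_le hc hk hkr hr hrn (j := l) (by omega))
    rw [Real.sqrt_mul (by linarith)] at h2
    have h1 : stageLength k r (l + 1 + 1) = 1 := by simp [stageLength]
    rw [h1, Nat.cast_one, one_mul, Nat.add_sub_cancel]
    exact h2.trans (by gcongr)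

end Parameters

theorem nonneg_and_le_of_le_mul {c : ℝ} (hc : c < 1) {n k r : ℕ} (hkr : k < r)
    (hr : (r : ℝ) ≤ c * n) : 0 ≤ c ∧ r ≤ n := by
  have hr0 : (0 : ℝ) < r := by exact_mod_cast (by omega : 0 < r)
  have hn0 : (0 : ℝ) ≤ n := Nat.cast_nonneg n
  refine ⟨?_, ?_⟩
  · by_contra! hneg
    nlinarith
  · have : (r : ℝ) ≤ n := by nlinarith
    exact_mod_cast this

theorem mainTheorem5 (k : ℕ) (hk : 1 ≤ k) :
    -- the learning graph with parameter `r`, its symmetry, its parameters and its complexity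
    (∀ c : ℝ, c < 1 → ∃ C : ℝ, 0 < C ∧
      ∀ n m r : ℕ, k < r → (r : ℝ) ≤ c * (n : ℝ) →
      ∀ a : (Fin n → Fin m) → Fin k → Fin n, IsMarking a →
      ∃ G : LearningGraphFor (kDistinctness n m k),
        IsKDistinctnessGraph r a G ∧
        G.IsInvariant ∧
        (∀ i ∈ Finset.Icc 1 (k + 1), G.IsSymmetricOn i) ∧
        (∀ x, kDistinctness n m k x = true →
          G.averageLength x 1 = (r : ℝ) - (k : ℝ) ∧
          (∀ e ∈ G.stage 1, G.speciality x e ≤ C) ∧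
          ∀ j ∈ Finset.Icc 2 (k + 1),
            G.averageLength x j = 1 ∧
            ∀ e ∈ G.stage j,
              G.speciality x e ≤ C * ((n : ℝ) ^ (j - 1) / (r : ℝ) ^ (j - 2))) ∧
        G.complexity ≤ C * kDistinctnessBound n k r) ∧
    -- no choice of `r` makes the bound smaller than `n ^ (k / (k + 1))`
    (∀ n r : ℕ, 1 ≤ r →
      (n : ℝ) ^ ((k : ℝ) / ((k : ℝ) + 1)) ≤ kDistinctnessBound n k r) ∧
    -- the choice `r = n ^ (k / (k + 1))`
    (∃ C : ℝ, 0 < C ∧ ∃ n₀ : ℕ, ∀ n r : ℕ, n₀ ≤ n →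
      r = ⌈(n : ℝ) ^ ((k : ℝ) / ((k : ℝ) + 1))⌉₊ →
      k < r ∧ r ≤ n ∧
      kDistinctnessBound n k r ≤ C * (n : ℝ) ^ ((k : ℝ) / ((k : ℝ) + 1)) ∧
      ∀ m : ℕ, ∀ a : (Fin n → Fin m) → Fin k → Fin n, IsMarking a →
      ∃ G : LearningGraphFor (kDistinctness n m k),
        IsKDistinctnessGraph r a G ∧
        G.complexity ≤ C * (n : ℝ) ^ ((k : ℝ) / ((k : ℝ) + 1))) := by
  refine ⟨fun c hc => ?_, rpow_le_kDistinctnessBound k hk, ?_⟩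
  · have hC : 0 < ((k : ℝ) / (1 - c)) ^ k := by
      have h1 : (0 : ℝ) < k := by exact_mod_cast hk
      have h2 : 0 < 1 - c := by linarith
      positivity
    refine ⟨((k : ℝ) / (1 - c)) ^ k, hC, fun n m r hkr hr a ha => ?_⟩
    obtain ⟨hc0, hrn⟩ := nonneg_and_le_of_le_mul hc hkr hr
    have hG := isKDistinctnessGraph_kDistinctnessGraphFor hkr hrn ha
    refine ⟨kDistinctnessGraphFor hkr hrn a ha, hG, isInvariant_kDistinctnessGraphFor hkr hrn ha,
      fun i hi => isSymmetricOn_kDistinctnessGraphFor hkr hrn ha hi,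
      fun x hx => ⟨?_, ?_, fun j hj => ?_⟩,
      complexity_kDistinctnessGraphFor_le_bound hc0 hc hk hkr hr hrn ha⟩
    · rw [averageLength_kDistinctnessGraphFor hkr hrn ha hx (by simp), stageLength, if_pos rfl,
        Nat.cast_sub hkr.le]
    · intro e he
      rw [hG.stage_eq 1 (by simp)] at he
      rw [speciality_kDistinctnessGraphFor hkr hrn ha hx (by simp) he]
      exact card_stage_one_div_le hc hk hkr hr hrn
    · rw [Finset.mem_Icc] at hj
      obtain ⟨l, rfl⟩ : ∃ l, j = l + 2 := ⟨j - 2, by omega⟩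
      have hj' : l + 2 ∈ Finset.Icc 1 (k + 1) := by rw [Finset.mem_Icc]; omega
      refine ⟨?_, fun e he => ?_⟩
      · rw [averageLength_kDistinctnessGraphFor hkr hrn ha hx hj']
        simp [stageLength]
      · rw [hG.stage_eq _ hj'] at he
        rw [speciality_kDistinctnessGraphFor hkr hrn ha hx hj' he]
        exact card_stage_add_two_div_le hc hk hkr hr hrn (by omega)
  -- For large `n` the chosen `r` is at most `n / 2`, so the first part applies with `c = 1 / 2`.
  · have hk1 : (1 : ℝ) ≤ k := by exact_mod_cast hk
    have hC : (1 : ℝ) ≤ ((k : ℝ) / (1 - 1 / 2)) ^ k := by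
      apply one_le_pow₀
      rw [one_le_div (by norm_num)]
      linarith
    refine ⟨((k : ℝ) / (1 - 1 / 2)) ^ k * ((k : ℝ) + 2), by positivity, (k + 4) ^ (k + 1),
      fun n r hn hr => ?_⟩
    obtain ⟨hkr, hr2, hB⟩ := ceil_rpow_bounds hk hn hr
    obtain ⟨-, hrn⟩ := nonneg_and_le_of_le_mul (by norm_num) hkr hr2
    refine ⟨hkr, hrn, hB.trans ?_, fun m a ha => ⟨kDistinctnessGraphFor hkr hrn a ha,
      isKDistinctnessGraph_kDistinctnessGraphFor hkr hrn ha, ?_⟩⟩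
    · rw [mul_assoc]
      exact le_mul_of_one_le_left (by positivity) hC
    · refine (complexity_kDistinctnessGraphFor_le_bound (by norm_num) (by norm_num) hk hkr hr2 hrn
        ha).trans ?_
      rw [mul_assoc]
      exact mul_le_mul_of_nonneg_left hB (by positivity)
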